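/- **Setting.** Let $D$ be a finite alphabet, identified with a finite abelian group (for instance $\mathbf Z_{|D|}$), let $n\ge 0$, and let $\mathcal D\subseteq D^n$ be the set of inputs. A quantum query algorithm on inputs $a\in D^N$ has a memory with basis states $|i,b,h,w\rangle$, where $i\in[N]\cup\{\text{null}\}$ is a query index, $b\in D$ is an answer register, $h$ is an output register spanning $\mathcal H$, and $w$ is work space (all finite-dimensional). It starts in a fixed basis state and alternates input-independent unitaries with queries $|i,b,h,w\rangle\mapsto|i,b+a_i,h,w\rangle$ (the null query acts as the identity). A matrix $\sigma$ indexed by a set of inputs $X$ is the Gram matrix of a state generation problem if $\sigma(x,y)=\langle\sigma_x|\sigma_y\rangle$ for unit vectors $|\sigma_x\rangle$ in a finite-dimensional complex space. A $T$-query algorithm generates $\sigma$ coherently with error at most $\epsilon$ if, for some target states $|\sigma_x\rangle\in\mathcal H$ with Gram matrix $\sigma$ and some default basis state $|\bar 0\rangle$ of all the registers other than the output register, its final state $|\mathcal P(x)\rangle$ satisfies $\Re\big(\langle \mathcal P(x)|(|\sigma_x\rangle\otimes|\bar 0\rangle)\big)\ge\sqrt{1-\epsilon}$ for every input $x$. The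 coherent quantum query complexity $Q^c_\epsilon(\sigma)$ is the least such $T$. The problem $\sigma^{\otimes k}$, with $\sigma^{\otimes k}\big((x^1,\dots,x^k),(y^1,\dots,y^k)\big)=\prod_{l}\sigma(x^l,y^l)$, has input set $\mathcal D^k\subseteq D^{kn}$: a query may ask for any letter $x^p_q$, $p\in[k]$, $q\in[n]$. Let $J$ be the all-ones matrix, $\circ$ the entrywise product, $\Delta_i(x,y)=\delta_{x_i,y_i}$, and $\|\cdot\|$ the operator norm. For a $\mathcal D\times\mathcal D$ matrix $A$ let $$\gamma_2(A)=\min\Big\{\max_{x\in\mathcal D}\max\{\|u_x\|^2,\|v_x\|^2\}\ :\ m\in\mathbf N,\ u_x,v_x\in\mathbf C^m,\ A(x,y)=\langle u_x|v_y\rangle\ \text{for all } x,y\in\mathcal D\Big\},$$ and let $$\mathrm{ADV}(\sigma)=\max_{\Gamma}\ \|\Gamma\circ(J-\sigma)\|,$$ where the maximum is over all hermitian $\mathcal D\times\mathcal D$ matrices $\Gamma$ with $I\pm\Gamma\circ(J-\Delta_i)\succeq0$ for all $i\in[n]$. **Theorem.** Let $\sigma$ be the Gram matrix of a state generation problem on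 $\mathcal D$ satisfying $(J-\sigma)\circ(J-\sigma)=\lambda(J-\sigma)$ for some real $\lambda>0$, and let $d=\mathrm{ADV}(\sigma)/\gamma_2(J-\sigma)$ (with $d=0$ if $\sigma=J$). Then for every integer $k\ge0$, every $0<\delta\le1$ and every $\gamma>0$, $$Q^c_{1-\delta^k}(\sigma^{\otimes k})\ \ge\ \frac{k\,\ln\!\Big(\delta\,\dfrac{1+2\gamma d}{1+\gamma d(2-\lambda)}\Big)}{2\ln(1+\gamma)} .$$ -/

import Mathlib

open scoped Matrix ComplexOrder

noncomputable section

namespace StateGen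

/-! ## The quantum query model -/

/-- Basis labels `|i, b, h, w⟩` of the memory of a query algorithm: a query index `i`
(`none` is the null query), an answer register `b`, an output register `h`, and work space `w`. -/
abbrev Register (ι D : Type*) (m w : ℕ) := Option ι × D × Fin m × Fin w

/-- The letter added by a query with index `i` when the input string is `a`;
the null query adds `0`. -/
def answer {ι D : Type*} [Zero D] (a : ι → D) : Option ι → D
  | none => 0
  | some i => a i

/-- One query to the input string `a`: the unitary `|i, b, h, w⟩ ↦ |i, b + a i, h, w⟩`
(on amplitudes). -/
def query {ι D : Type*} [AddCommGroup D] {m w : ℕ} (a : ι → D)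
    (ψ : Register ι D m w → ℂ) : Register ι D m w → ℂ :=
  fun s => ψ (s.1, s.2.1 - answer a s.1, s.2.2)

/-- A quantum query algorithm with an `m`-dimensional output register: a basis state in which the
memory starts, and input-independent unitaries `U 0, U 1, …` (`U t` is applied after the
`t`-th query). -/
structure Algorithm (ι D : Type*) [Fintype ι] [DecidableEq ι] [Fintype D] [DecidableEq D]
    (m w : ℕ) where
  start : Register ι D m w
  U : ℕ → Matrix.unitaryGroup (Register ι D m w) ℂ

/-- The state of the algorithm on input string `a` after `t` queries. -/
def Algorithm.state {ι D : Type*} [Fintype ι] [DecidableEq ι] [Fintype D] [DecidableEq D]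
    [AddCommGroup D] {m w : ℕ} (P : Algorithm ι D m w) (a : ι → D) :
    ℕ → Register ι D m w → ℂ
  | 0 => (P.U 0 : Matrix _ _ ℂ) *ᵥ Pi.single P.start 1
  | t + 1 => (P.U (t + 1) : Matrix _ _ ℂ) *ᵥ query a (P.state a t)

/-! ## State generation -/

/-- The family `s` of vectors of `ℂ^m` has Gram matrix `σ`, i.e. `σ x y = ⟨s x | s y⟩`. -/
def HasGram {X : Type*} {m : ℕ} (s : X → Fin m → ℂ) (σ : Matrix X X ℂ) : Prop :=
  ∀ x y, σ x y = star (s x) ⬝ᵥ s y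

/-- `σ` is the Gram matrix of a state generation problem: the Gram matrix of a family of
unit vectors. -/
def IsTargetGram {X : Type*} (σ : Matrix X X ℂ) : Prop :=
  ∃ (m : ℕ) (s : X → Fin m → ℂ), (∀ x, star (s x) ⬝ᵥ s x = 1) ∧ HasGram s σ

/-- The vector `φ ⊗ |z⟩`: the output register is in state `φ` and all other registers
are in the basis state `z`. -/
def withDefault {ι D : Type*} [DecidableEq ι] [DecidableEq D] {m w : ℕ}
    (φ : Fin m → ℂ) (z : Option ι × D × Fin w) : Register ι D m w → ℂ :=
  fun s => if (s.1, s.2.1, s.2.2.2) = z then φ s.2.2.1 else 0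

/-- `T` queries suffice to generate `σ` coherently with error at most `ε`. Here `inp x` is the
input string with label `x`. There are target states with Gram matrix `σ` and an algorithm such
that the final state `P(x)` satisfies `Re ⟨P(x) | σ_x ⊗ default⟩ ≥ √(1 - ε)` for all `x`. -/
def CoherentlyGenerates {X ι D : Type*} [Fintype ι] [DecidableEq ι] [Fintype D] [DecidableEq D]
    [AddCommGroup D] (inp : X → ι → D) (σ : Matrix X X ℂ) (ε : ℝ) (T : ℕ) : Prop :=
  ∃ (m w : ℕ) (s : X → Fin m → ℂ) (P : Algorithm ι D m w) (z : Option ι × D × Fin w),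
    HasGram s σ ∧
    ∀ x, Real.sqrt (1 - ε) ≤ (star (P.state (inp x) T) ⬝ᵥ withDefault (s x) z).re

/-- The coherent quantum query complexity of `σ` with error `ε`: the least number of queries
(`⊤` if no number of queries suffices). -/
def coherentComplexity {X ι D : Type*} [Fintype ι] [DecidableEq ι] [Fintype D] [DecidableEq D]
    [AddCommGroup D] (inp : X → ι → D) (σ : Matrix X X ℂ) (ε : ℝ) : ℕ∞ :=
  sInf {q : ℕ∞ | ∃ T : ℕ, CoherentlyGenerates inp σ ε T ∧ q = T}

/-- The `k`-fold tensor power of a matrix. -/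
def tensorPow {X : Type*} (σ : Matrix X X ℂ) (k : ℕ) : Matrix (Fin k → X) (Fin k → X) ℂ :=
  Matrix.of fun x y => ∏ l, σ (x l) (y l)

/-- The input string, of length `k * n`, formed by `k` inputs from the domain `𝒟 ⊆ D^n`. -/
def inputs {n : ℕ} {D : Type*} (𝒟 : Finset (Fin n → D)) (k : ℕ) :
    (Fin k → 𝒟) → Fin k × Fin n → D :=
  fun x j => (x j.1 : Fin n → D) j.2

/-! ## The factorization norm and the additive adversary bound -/

/-- The all-ones matrix `J`. -/
def allOnes (X : Type*) : Matrix X X ℂ := Matrix.of fun _ _ => 1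

/-- The operator (spectral) norm of a matrix. -/
def opNorm {X : Type*} [Fintype X] [DecidableEq X] (A : Matrix X X ℂ) : ℝ :=
  ‖Matrix.toEuclideanCLM (n := X) (𝕜 := ℂ) A‖

/-- The factorization norm `γ₂(A)`: the least `c` such that `A x y = ⟨u x | v y⟩` for vectors of
some `ℂ^m` with `‖u x‖² ≤ c` and `‖v x‖² ≤ c` for all `x`. -/
def gammaTwo {X : Type*} (A : Matrix X X ℂ) : ℝ :=
  sInf {c : ℝ | 0 ≤ c ∧ ∃ (m : ℕ) (u v : X → EuclideanSpace ℂ (Fin m)),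
    (∀ x, ‖u x‖ ^ 2 ≤ c ∧ ‖v x‖ ^ 2 ≤ c) ∧ ∀ x y, A x y = inner ℂ (u x) (v y)}

/-- The matrix `Δ i`, with entries `1` if `x i = y i` and `0` otherwise. -/
def Delta {n : ℕ} {D : Type*} [DecidableEq D] (𝒟 : Finset (Fin n → D)) (i : Fin n) :
    Matrix 𝒟 𝒟 ℂ :=
  Matrix.of fun x y => if (x : Fin n → D) i = (y : Fin n → D) i then 1 else 0

/-- The additive adversary bound: the maximum of `‖Γ ∘ (J - σ)‖` over hermitian `Γ` with
`I ± Γ ∘ (J - Δ i) ⪰ 0` for all `i`. If `σ` has unit diagonal the set below is bounded, since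
distinct elements of `𝒟` differ at some position `i`. -/
def ADV {n : ℕ} {D : Type*} [DecidableEq D] (𝒟 : Finset (Fin n → D)) (σ : Matrix 𝒟 𝒟 ℂ) : ℝ :=
  sSup {r : ℝ | ∃ Γ : Matrix 𝒟 𝒟 ℂ, Γ.IsHermitian ∧
    (∀ i, (1 + Γ ⊙ (allOnes 𝒟 - Delta 𝒟 i)).PosSemidef ∧
      (1 - Γ ⊙ (allOnes 𝒟 - Delta 𝒟 i)).PosSemidef) ∧
    r = opNorm (Γ ⊙ (allOnes 𝒟 - σ))}

end StateGen

end

/-!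
The proof is a multiplicative adversary argument. For a positive matrix `W` on the set of inputs
and a weight vector `v`, the progress after `t` queries is the expectation of `W ⊗ 1` in the vector
`∑ x, v x |x⟩ ⊗ |ψ_t(x)⟩`, which is the pairing of `W` with a weighted Gram matrix.

*The form.* Let `Γ` be feasible for the additive adversary bound, with top eigenvalue `e = ‖Γ‖`,
top unit eigenvector `v`, and `Γ ⊙ (J - σ) = λ Γ`. For `W = 1 + γ (e - Γ)` the initial progress is
`⟨v| W |v⟩ = 1`. Tensor powers `W^{⊗k}`, `v^{⊗k}` are used for `k` copies, and the initial progress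
is still `1`.

*Queries.* A query at position `i` does not change the Gram entries between inputs that agree at
`i`. The rest `W ⊙ (J - Δ i) = -γ Γ ⊙ (J - Δ i)` lies between `-γ` and `γ`, and `W ≥ 1`, so one
query multiplies the progress by at most `1 + 2 γ ≤ (1 + γ) ^ 2`; in the tensor power the matrix
`1` is replaced by the tensor product with `1` in the queried block and `W` in the others
(`isQueryBounded_tensorPow`, `re_pairing_state_le`).

*Output.* By Cauchy–Schwarz for the form `W^{⊗k}`, an overlap `δ ^ (k / 2)` with the target states
forces the final progress to be at least `δ ^ k / S ^ k`, where `S` is the expectation of `W⁻¹` in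
the target state of a single copy (`pow_le_of_coherentlyGenerates`). As `1 ≤ W ≤ 1 + 2 γ e`,
the inverse lies below the chord `1 - (W - 1) / (1 + 2 γ e)` (`posSemidef_chord_sub_inv`), and
`Γ ⊙ σ = (1 - λ) Γ` gives `S ≤ (1 + γ e (2 - λ)) / (1 + 2 γ e)`.

*The witness.* Let `Γ₀` be feasible with `‖Γ₀ ⊙ (J - σ)‖` close to `ADV`. The entries of `J - σ`
are `0` or `λ`, so `Γ₀ ⊙ (J - σ)` satisfies the equation required of `Γ`. Entrywise multiplication
by `J - σ` increases norms of hermitian matrices by at most the factor `γ₂(J - σ)`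
(`posSemidef_smul_sub_hadamard`), so a multiple of `Γ₀ ⊙ (J - σ)` is feasible and has norm `e`, for
any `e < d` (`pow_le_of_lt`). The bound for `d` itself follows by letting `e` tend to `d`.
-/

namespace StateGen

/-! ### Gram matrices and the progress measure -/

section Pairing

variable {X R : Type*}

/-- The Gram matrix `⟨Ψ x | Ψ y⟩` of a family of vectors. -/
def gramMatrix [Fintype R] (Ψ : X → R → ℂ) : Matrix X X ℂ :=
  Matrix.of fun x y => star (Ψ x) ⬝ᵥ Ψ y

variable [Fintype X]

/-- The bilinear pairing `∑ x y, W x y * G x y`. If `G` is the Gram matrix of `Ψ`, this is the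
expectation of `W ⊗ 1` in the vector `∑ x, |x⟩ ⊗ Ψ x`. -/
def pairing (W G : Matrix X X ℂ) : ℂ := ∑ x, ∑ y, W x y * G x y

theorem pairing_add_left (W W' G : Matrix X X ℂ) :
    pairing (W + W') G = pairing W G + pairing W' G := by
  simp [pairing, add_mul, Finset.sum_add_distrib]

theorem pairing_sub_left (W W' G : Matrix X X ℂ) :
    pairing (W - W') G = pairing W G - pairing W' G := by
  simp [pairing, sub_mul, Finset.sum_sub_distrib]

theorem pairing_smul_left (c : ℂ) (W G : Matrix X X ℂ) :
    pairing (c • W) G = c * pairing W G := by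
  simp [pairing, Finset.mul_sum, mul_assoc]

theorem pairing_sum_right {κ : Type*} (s : Finset κ) (W : Matrix X X ℂ)
    (G : κ → Matrix X X ℂ) : pairing W (∑ i ∈ s, G i) = ∑ i ∈ s, pairing W (G i) := by
  simp only [pairing, Matrix.sum_apply, Finset.mul_sum]
  exact (Finset.sum_congr rfl fun x _ => Finset.sum_comm).trans Finset.sum_comm

variable [Fintype R]

theorem pairing_gramMatrix (W : Matrix X X ℂ) (Ψ : X → R → ℂ) :
    pairing W (gramMatrix Ψ) = ∑ r, star (fun x => Ψ x r) ⬝ᵥ W *ᵥ fun x => Ψ x r := by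
  simp only [pairing, gramMatrix, Matrix.of_apply, dotProduct, Matrix.mulVec, Finset.mul_sum,
    Pi.star_apply]
  calc _ = ∑ x, ∑ r, ∑ y, W x y * (star (Ψ x r) * Ψ y r) :=
        Finset.sum_congr rfl fun x _ => Finset.sum_comm
    _ = ∑ r, ∑ x, ∑ y, W x y * (star (Ψ x r) * Ψ y r) := Finset.sum_comm
    _ = _ := Finset.sum_congr rfl fun r _ => Finset.sum_congr rfl fun x _ =>
        Finset.sum_congr rfl fun y _ => by ring

theorem pairing_gramMatrix_nonneg {W : Matrix X X ℂ} (hW : W.PosSemidef) (Ψ : X → R → ℂ) :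
    0 ≤ pairing W (gramMatrix Ψ) := by
  rw [pairing_gramMatrix]
  exact Finset.sum_nonneg fun r _ => hW.dotProduct_mulVec_nonneg _

theorem re_pairing_gramMatrix_nonneg {W : Matrix X X ℂ} (hW : W.PosSemidef) (Ψ : X → R → ℂ) :
    0 ≤ (pairing W (gramMatrix Ψ)).re :=
  (Complex.le_def.1 (pairing_gramMatrix_nonneg hW Ψ)).1

/-- Cauchy–Schwarz for the form defined by `W`, with `V = W⁻¹`, in the polarised form obtained by
expanding the form at `Ψ - t V τ`. -/
theorem two_mul_overlap_le [DecidableEq X] {W V : Matrix X X ℂ} (hW : W.PosSemidef)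
    (hV : V.IsHermitian) (hWV : W * V = 1) (Ψ τ : X → R → ℂ) (t : ℝ) :
    2 * t * (∑ x, star (Ψ x) ⬝ᵥ τ x).re
      ≤ (pairing W (gramMatrix Ψ)).re + t ^ 2 * (pairing V (gramMatrix τ)).re := by
  have hVW : V * W = 1 := mul_eq_one_comm.1 hWV
  have key : ∀ p q : X → ℂ, 2 * t * (star p ⬝ᵥ q).re
      ≤ (star p ⬝ᵥ W *ᵥ p).re + t ^ 2 * (star q ⬝ᵥ V *ᵥ q).re := by
    intro p q
    have h := hW.dotProduct_mulVec_nonneg (p - (t : ℂ) • V *ᵥ q)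
    have h1 : star (V *ᵥ q) ⬝ᵥ W *ᵥ p = star q ⬝ᵥ p := by
      rw [Matrix.star_mulVec, hV.eq, ← Matrix.dotProduct_mulVec, Matrix.mulVec_mulVec, hVW,
        Matrix.one_mulVec]
    have h2 : star (V *ᵥ q) ⬝ᵥ q = star q ⬝ᵥ V *ᵥ q := by
      rw [Matrix.star_mulVec, hV.eq, ← Matrix.dotProduct_mulVec]
    have h3 : star q ⬝ᵥ p = star (star p ⬝ᵥ q) := by
      rw [Matrix.star_dotProduct]
    simp only [Matrix.mulVec_sub, Matrix.mulVec_smul, Matrix.mulVec_mulVec, hWV,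
      Matrix.one_mulVec, star_sub, star_smul, sub_dotProduct, dotProduct_sub, smul_dotProduct,
      dotProduct_smul, h1, h2, h3, smul_eq_mul] at h
    have h4 := (Complex.le_def.1 h).1
    simp at h4
    nlinarith [h4]
  have hsum : ∑ x, star (Ψ x) ⬝ᵥ τ x
      = ∑ r, star (fun x => Ψ x r) ⬝ᵥ fun x => τ x r := by
    simp only [dotProduct, Pi.star_apply]
    exact Finset.sum_comm
  rw [hsum, pairing_gramMatrix, pairing_gramMatrix, Complex.re_sum, Complex.re_sum,
    Complex.re_sum, Finset.mul_sum, Finset.mul_sum, ← Finset.sum_add_distrib]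
  exact Finset.sum_le_sum fun r _ => key _ _

end Pairing

/-! ### Tensor products of matrices -/

section TensorProduct

variable {X : Type*} {k : ℕ}

/-- The tensor product of the matrices `M l`. -/
def piKronecker (M : Fin k → Matrix X X ℂ) : Matrix (Fin k → X) (Fin k → X) ℂ :=
  Matrix.of fun x y => ∏ l, M l (x l) (y l)

theorem piKronecker_update_apply (M : Fin k → Matrix X X ℂ) (p : Fin k) (A : Matrix X X ℂ)
    (x y : Fin k → X) : piKronecker (Function.update M p A) x y
      = A (x p) (y p) * ∏ l ∈ Finset.univ.erase p, M l (x l) (y l) := by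
  rw [piKronecker, Matrix.of_apply, ← Finset.mul_prod_erase _ _ (Finset.mem_univ p)]
  congr 1
  · simp
  · refine Finset.prod_congr rfl fun l hl => ?_
    rw [Function.update_of_ne (Finset.ne_of_mem_erase hl)]

theorem piKronecker_update_add (M : Fin k → Matrix X X ℂ) (p : Fin k) (A B : Matrix X X ℂ) :
    piKronecker (Function.update M p (A + B))
      = piKronecker (Function.update M p A) + piKronecker (Function.update M p B) := by
  ext x y
  simp [piKronecker_update_apply, add_mul]

theorem piKronecker_update_sub (M : Fin k → Matrix X X ℂ) (p : Fin k) (A B : Matrix X X ℂ) :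
    piKronecker (Function.update M p (A - B))
      = piKronecker (Function.update M p A) - piKronecker (Function.update M p B) := by
  ext x y
  simp [piKronecker_update_apply, sub_mul]

theorem piKronecker_update_smul (M : Fin k → Matrix X X ℂ) (p : Fin k) (c : ℂ)
    (A : Matrix X X ℂ) : piKronecker (Function.update M p (c • A))
      = c • piKronecker (Function.update M p A) := by
  ext x y
  simp [piKronecker_update_apply, mul_assoc]

theorem piKronecker_one [DecidableEq X] :
    piKronecker (fun _ : Fin k => (1 : Matrix X X ℂ)) = 1 := by
  ext x y
  simp only [piKronecker, Matrix.of_apply, Matrix.one_apply, Finset.prod_ite_zero,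
    Finset.prod_const_one, Finset.mem_univ, true_imp_iff, funext_iff]

theorem piKronecker_conjTranspose (M : Fin k → Matrix X X ℂ) :
    (piKronecker M)ᴴ = piKronecker fun l => (M l)ᴴ := by
  ext x y
  simp [piKronecker]

variable [Fintype X]

theorem sum_sum_prod_eq_pow (f : X → X → ℂ) :
    ∑ x : Fin k → X, ∑ y : Fin k → X, ∏ l, f (x l) (y l) = (∑ x, ∑ y, f x y) ^ k := by
  have h (x : Fin k → X) : ∑ y : Fin k → X, ∏ l, f (x l) (y l) = ∏ l, ∑ y, f (x l) y := by
    rw [Finset.prod_univ_sum, Fintype.piFinset_univ]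
  simp_rw [h]
  rw [← Fintype.piFinset_univ, ← Finset.prod_univ_sum (fun _ => Finset.univ)
    (fun _ x => ∑ y, f x y)]
  simp

theorem piKronecker_mul (M N : Fin k → Matrix X X ℂ) :
    piKronecker M * piKronecker N = piKronecker fun l => M l * N l := by
  ext x y
  simp only [piKronecker, Matrix.mul_apply, Matrix.of_apply, Finset.prod_univ_sum,
    Fintype.piFinset_univ, Finset.prod_mul_distrib]

open scoped MatrixOrder Matrix.Norms.L2Operator in
theorem piKronecker_posSemidef [DecidableEq X] {M : Fin k → Matrix X X ℂ}
    (hM : ∀ l, (M l).PosSemidef) : (piKronecker M).PosSemidef := by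
  choose B hB using fun l => CStarAlgebra.nonneg_iff_eq_star_mul_self.1 (hM l).nonneg
  have h : piKronecker M = (piKronecker B)ᴴ * piKronecker B := by
    rw [piKronecker_conjTranspose, piKronecker_mul]
    congr 1
    exact funext hB
  rw [h]
  exact Matrix.posSemidef_conjTranspose_mul_self _

end TensorProduct

/-! ### Growth of the progress measure under queries -/

section Queries

variable {X ι D : Type*} {m w : ℕ}

/-- The form `W` changes under one query by at most a factor `1 + 2 * γ`, as certified for each
position `j` by a splitting `W = (W - E) + E` in which `W - E` only relates inputs that agree at
`j` and the remainder `E` lies between `-γ N` and `γ N` for some `N ≤ W` that also only relates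
inputs that agree at `j`. -/
def IsQueryBounded (inp : X → ι → D) (W : Matrix X X ℂ) (γ : ℝ) : Prop :=
  ∀ j, ∃ N E : Matrix X X ℂ,
    (∀ x y, inp x j ≠ inp y j → N x y = 0) ∧ (∀ x y, inp x j ≠ inp y j → (W - E) x y = 0) ∧
    ((γ : ℂ) • N + E).PosSemidef ∧ ((γ : ℂ) • N - E).PosSemidef ∧ (W - N).PosSemidef

theorem pairing_congr_right [Fintype X] {N G G' : Matrix X X ℂ}
    (h : ∀ x y, N x y = 0 ∨ G x y = G' x y) : pairing N G = pairing N G' :=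
  Finset.sum_congr rfl fun x _ => Finset.sum_congr rfl fun y _ => by
    rcases h x y with h | h <;> simp [h]

theorem gramMatrix_mulVec {R : Type*} [Fintype R] [DecidableEq R]
    (U : Matrix.unitaryGroup R ℂ) (Ψ : X → R → ℂ) :
    gramMatrix (fun x => (U : Matrix R R ℂ) *ᵥ Ψ x) = gramMatrix Ψ := by
  ext x y
  have hU : (U : Matrix R R ℂ)ᴴ * (U : Matrix R R ℂ) = 1 :=
    Matrix.mem_unitaryGroup_iff'.1 U.2
  simp only [gramMatrix, Matrix.of_apply]
  rw [Matrix.star_mulVec, ← Matrix.dotProduct_mulVec, Matrix.mulVec_mulVec, hU, Matrix.one_mulVec]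

variable [Fintype ι] [Fintype D]

/-- A Gram matrix splits according to the content of the query register. -/
theorem gramMatrix_eq_sum (Ψ : X → Register ι D m w → ℂ) :
    gramMatrix Ψ = ∑ i, gramMatrix fun x s => Ψ x (i, s) := by
  ext x y
  simp only [gramMatrix, Matrix.sum_apply, Matrix.of_apply, dotProduct, Pi.star_apply]
  exact Fintype.sum_prod_type _

variable [AddCommGroup D]

omit [Fintype ι] [Fintype D] in
theorem query_smul (a : ι → D) (c : ℂ) (ψ : Register ι D m w → ℂ) :
    query a (c • ψ) = c • query a ψ := rfl

omit [Fintype ι] in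
/-- A query at a position where two inputs agree shifts both answer registers by the same
letter, which preserves the inner product. -/
theorem gramMatrix_query_apply (inp : X → ι → D) (Ψ : X → Register ι D m w → ℂ) {i : Option ι}
    {x y : X} (h : answer (inp x) i = answer (inp y) i) :
    gramMatrix (fun x s => query (inp x) (Ψ x) (i, s)) x y
      = gramMatrix (fun x s => Ψ x (i, s)) x y := by
  simp only [gramMatrix, Matrix.of_apply, dotProduct, Pi.star_apply, query, h]
  exact Equiv.sum_comp ((Equiv.subRight (answer (inp y) i)).prodCongr (Equiv.refl _))
    fun s => star (Ψ x (i, s)) * Ψ y (i, s)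

variable [Fintype X]

/-- One query increases the progress measure by at most a factor `1 + 2 * γ`. -/
theorem re_pairing_query_le {inp : X → ι → D} {W : Matrix X X ℂ} {γ : ℝ} (hγ : 0 ≤ γ)
    (hW : W.PosSemidef) (h : IsQueryBounded inp W γ) (Ψ : X → Register ι D m w → ℂ) :
    (pairing W (gramMatrix fun x => query (inp x) (Ψ x))).re
      ≤ (1 + 2 * γ) * (pairing W (gramMatrix Ψ)).re := by
  rw [gramMatrix_eq_sum, gramMatrix_eq_sum Ψ, pairing_sum_right, pairing_sum_right,
    Complex.re_sum, Complex.re_sum, Finset.mul_sum]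
  refine Finset.sum_le_sum fun i _ => ?_
  set G' := gramMatrix (fun x s => query (inp x) (Ψ x) (i, s)) with hG'
  set G := gramMatrix (fun x s => Ψ x (i, s)) with hG
  have hWG : 0 ≤ (pairing W G).re := re_pairing_gramMatrix_nonneg hW _
  rcases i with _ | j
  · have e : pairing W G' = pairing W G :=
      pairing_congr_right fun x y => Or.inr (gramMatrix_query_apply inp Ψ rfl)
    rw [e]
    nlinarith
  · obtain ⟨N, E, hN, hE, h1, h2, h3⟩ := h j
    have agree {M : Matrix X X ℂ} (hM : ∀ x y, inp x j ≠ inp y j → M x y = 0) :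
        pairing M G' = pairing M G := pairing_congr_right fun x y => by
      by_cases hxy : inp x j = inp y j
      · exact Or.inr (gramMatrix_query_apply inp Ψ hxy)
      · exact Or.inl (hM x y hxy)
    have eN := congrArg Complex.re (agree hN)
    have eE := congrArg Complex.re (agree hE)
    have p1 : 0 ≤ (pairing _ G).re := re_pairing_gramMatrix_nonneg h1 _
    have p2 : 0 ≤ (pairing _ G').re := re_pairing_gramMatrix_nonneg h2 _
    have p3 : 0 ≤ (pairing _ G).re := re_pairing_gramMatrix_nonneg h3 _
    simp only [pairing_add_left, pairing_sub_left, pairing_smul_left, Complex.add_re,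
      Complex.sub_re, Complex.re_ofReal_mul] at p1 p2 p3 eE
    nlinarith [mul_nonneg hγ p3]

variable [DecidableEq ι] [DecidableEq D]

omit [Fintype X] in
theorem gramMatrix_state_zero (P : Algorithm ι D m w) (inp : X → ι → D) (v : X → ℂ) (x y : X) :
    gramMatrix (fun x => v x • P.state (inp x) 0) x y = star (v x) * v y := by
  have h : (fun x => v x • P.state (inp x) 0)
      = fun x => ((P.U 0 : Matrix _ _ ℂ)) *ᵥ (v x • Pi.single P.start 1) := by
    funext x
    rw [Matrix.mulVec_smul]
    rfl
  rw [h, gramMatrix_mulVec]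
  simp [gramMatrix, mul_comm]

/-- After `T` queries, the progress measure has grown by at most a factor `(1 + 2 * γ) ^ T`. -/
theorem re_pairing_state_le {inp : X → ι → D} {W : Matrix X X ℂ} {γ : ℝ} (hγ : 0 ≤ γ)
    (hW : W.PosSemidef) (h : IsQueryBounded inp W γ) (P : Algorithm ι D m w) (v : X → ℂ) (T : ℕ) :
    (pairing W (gramMatrix fun x => v x • P.state (inp x) T)).re
      ≤ (1 + 2 * γ) ^ T * (star v ⬝ᵥ W *ᵥ v).re := by
  induction T with
  | zero =>
    have e : pairing W (gramMatrix fun x => v x • P.state (inp x) 0) = star v ⬝ᵥ W *ᵥ v := by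
      simp only [pairing, gramMatrix_state_zero, dotProduct, Matrix.mulVec, Finset.mul_sum,
        Pi.star_apply]
      exact Finset.sum_congr rfl fun x _ => Finset.sum_congr rfl fun y _ => by ring
    rw [e, pow_zero, one_mul]
  | succ t ih =>
    have e : (fun x => v x • P.state (inp x) (t + 1)) = fun x =>
        ((P.U (t + 1) : Matrix _ _ ℂ)) *ᵥ query (inp x) (v x • P.state (inp x) t) := by
      funext x
      rw [query_smul, Matrix.mulVec_smul]
      rfl
    rw [e, gramMatrix_mulVec]
    calc _ ≤ (1 + 2 * γ) * _ := re_pairing_query_le hγ hW h _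
      _ ≤ (1 + 2 * γ) * ((1 + 2 * γ) ^ t * (star v ⬝ᵥ W *ᵥ v).re) := by gcongr
      _ = _ := by ring

end Queries

section Output

variable {X ι D : Type*} [Fintype ι] [Fintype D] [DecidableEq ι] [DecidableEq D] {m w : ℕ}

theorem withDefault_dotProduct (φ φ' : Fin m → ℂ) (z : Option ι × D × Fin w) :
    star (withDefault φ z) ⬝ᵥ withDefault φ' z = star φ ⬝ᵥ φ' := by
  obtain ⟨i, b, c⟩ := z
  simp only [dotProduct, Pi.star_apply, withDefault, Prod.mk.injEq]
  rw [Fintype.sum_prod_type, Finset.sum_eq_single i, Fintype.sum_prod_type,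
    Finset.sum_eq_single b, Fintype.sum_prod_type]
  · refine Finset.sum_congr rfl fun h _ => ?_
    rw [Finset.sum_eq_single c] <;> simp +contextual
  all_goals simp +contextual

end Output

/-! ### Query bounds for tensor powers and the output condition -/

/-- The tensor power of a form `W ≥ 1` is query bounded. In the slot of the queried block, `W` is
split as `W ⊙ Δ i + W ⊙ (J - Δ i)`, and `N` carries the identity there, which relates only equal
inputs. -/
theorem isQueryBounded_tensorPow {n : ℕ} {D : Type*} [DecidableEq D] {𝒟 : Finset (Fin n → D)}
    {W : Matrix 𝒟 𝒟 ℂ} {γ : ℝ} (hW : W.PosSemidef) (hW1 : (W - 1).PosSemidef)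
    (hadd : ∀ i, ((γ : ℂ) • 1 + W ⊙ (allOnes 𝒟 - Delta 𝒟 i)).PosSemidef)
    (hsub : ∀ i, ((γ : ℂ) • 1 - W ⊙ (allOnes 𝒟 - Delta 𝒟 i)).PosSemidef) (k : ℕ) :
    IsQueryBounded (inputs 𝒟 k) (tensorPow W k) γ := by
  rintro ⟨p, q⟩
  have hWk : tensorPow W k = piKronecker (Function.update (fun _ => W) p W) := by
    rw [Function.update_eq_self p (fun _ => W)]
    rfl
  have psd {M : Matrix 𝒟 𝒟 ℂ} (hM : M.PosSemidef) :
      (piKronecker (Function.update (fun _ : Fin k => W) p M)).PosSemidef := by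
    refine piKronecker_posSemidef fun l => ?_
    rcases eq_or_ne l p with rfl | h
    · simpa using hM
    · simpa [h] using hW
  refine ⟨piKronecker (Function.update (fun _ => W) p 1),
    piKronecker (Function.update (fun _ => W) p (W ⊙ (allOnes 𝒟 - Delta 𝒟 q))), ?_, ?_, ?_, ?_, ?_⟩
  · intro x y hxy
    have h : x p ≠ y p := fun h => hxy (by simp [inputs, h])
    simp [piKronecker_update_apply, h]
  · intro x y hxy
    have h : (x p : Fin n → D) q ≠ (y p : Fin n → D) q := hxy
    rw [hWk, ← piKronecker_update_sub, piKronecker_update_apply]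
    simp [allOnes, Delta, h]
  · rw [← piKronecker_update_smul, ← piKronecker_update_add]
    exact psd (hadd q)
  · rw [← piKronecker_update_smul, ← piKronecker_update_sub]
    exact psd (hsub q)
  · rw [hWk, ← piKronecker_update_sub]
    exact psd hW1

theorem gramMatrix_smul_of_hasGram {X : Type*} {m : ℕ} {s : X → Fin m → ℂ} {σ : Matrix X X ℂ}
    (h : HasGram s σ) (v : X → ℂ) :
    gramMatrix (fun x => v x • s x) = Matrix.of fun x y => star (v x) * v y * σ x y := by
  ext x y
  simp [gramMatrix, h x y]
  ring

theorem pairing_tensorPow {X : Type*} [Fintype X] (V σ : Matrix X X ℂ) (v : X → ℂ) (k : ℕ) :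
    pairing (tensorPow V k)
        (Matrix.of fun x y => star (∏ l, v (x l)) * (∏ l, v (y l)) * tensorPow σ k x y)
      = pairing V (Matrix.of fun x y => star (v x) * v y * σ x y) ^ k := by
  rw [pairing, pairing, ← sum_sum_prod_eq_pow]
  refine Finset.sum_congr rfl fun x _ => Finset.sum_congr rfl fun y _ => ?_
  simp [tensorPow, Finset.prod_mul_distrib]

theorem tensorPow_dotProduct_mulVec {X : Type*} [Fintype X] (W : Matrix X X ℂ) (v : X → ℂ)
    (k : ℕ) : star (fun x : Fin k → X => ∏ l, v (x l)) ⬝ᵥ tensorPow W k *ᵥ (fun x => ∏ l, v (x l))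
      = (star v ⬝ᵥ W *ᵥ v) ^ k := by
  have h {Y : Type _} [Fintype Y] (M : Matrix Y Y ℂ) (u : Y → ℂ) :
      star u ⬝ᵥ M *ᵥ u = pairing M (Matrix.of fun x y => star (u x) * u y * 1) := by
    simp only [pairing, dotProduct, Matrix.mulVec, Finset.mul_sum, Pi.star_apply, Matrix.of_apply]
    exact Finset.sum_congr rfl fun x _ => Finset.sum_congr rfl fun y _ => by ring
  rw [h, h]
  have := pairing_tensorPow W (allOnes X) v k
  simpa [tensorPow, allOnes] using this

/-- Comparison of the initial and the final value of the progress measure: the initial value is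
`(⟨v| W |v⟩) ^ k = 1`, and overlap `δ ^ (k / 2)` with the target states forces the final value to
be at least `δ ^ k / S ^ k`, where `S` bounds the expectation of `W⁻¹` in the target state of a
single copy. -/
theorem pow_le_of_coherentlyGenerates {n : ℕ} {D : Type*} [Fintype D] [DecidableEq D]
    [AddCommGroup D] {𝒟 : Finset (Fin n → D)} {σ W V : Matrix 𝒟 𝒟 ℂ} (hσ : IsTargetGram σ)
    {γ : ℝ} (hγ : 0 ≤ γ) (hW1 : (W - 1).PosSemidef) (hV : V.PosSemidef) (hWV : W * V = 1)
    (hadd : ∀ i, ((γ : ℂ) • 1 + W ⊙ (allOnes 𝒟 - Delta 𝒟 i)).PosSemidef)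
    (hsub : ∀ i, ((γ : ℂ) • 1 - W ⊙ (allOnes 𝒟 - Delta 𝒟 i)).PosSemidef)
    {v : 𝒟 → ℂ} (hv : star v ⬝ᵥ v = 1) (hWv : star v ⬝ᵥ W *ᵥ v = 1) {S : ℝ} (hS : 0 < S)
    (hVS : (pairing V (Matrix.of fun x y => star (v x) * v y * σ x y)).re ≤ S)
    {k T : ℕ} {δ : ℝ} (hδ : 0 ≤ δ)
    (hT : CoherentlyGenerates (inputs 𝒟 k) (tensorPow σ k) (1 - δ ^ k) T) :
    δ ^ k ≤ S ^ k * (1 + 2 * γ) ^ T := by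
  obtain ⟨m, w, s, P, z, hs, hP⟩ := hT
  obtain ⟨m₀, s₀, -, hs₀⟩ := hσ
  rw [sub_sub_cancel] at hP
  have hW : W.PosSemidef := by simpa using hW1.add Matrix.PosSemidef.one
  have hWk : (tensorPow W k).PosSemidef := piKronecker_posSemidef fun _ => hW
  have hVk : (tensorPow V k).PosSemidef := piKronecker_posSemidef fun _ => hV
  have hWVk : tensorPow W k * tensorPow V k = 1 := by
    refine (piKronecker_mul _ _).trans ?_
    simp only [hWV, piKronecker_one]
  set u : (Fin k → 𝒟) → ℂ := fun x => ∏ l, v (x l) with hu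
  set Ψ := fun x => u x • P.state (inputs 𝒟 k x) T with hΨ
  set τ : (Fin k → 𝒟) → Register (Fin k × Fin n) D m w → ℂ :=
    fun x => u x • withDefault (s x) z with hτ
  have hinit : (pairing (tensorPow W k) (gramMatrix Ψ)).re ≤ (1 + 2 * γ) ^ T := by
    have := re_pairing_state_le hγ hWk (isQueryBounded_tensorPow hW hW1 hadd hsub k) P u T
    rwa [hu, tensorPow_dotProduct_mulVec, hWv, one_pow, Complex.one_re, mul_one] at this
  have hfinal : (pairing (tensorPow V k) (gramMatrix τ)).re ≤ S ^ k := by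
    have e : gramMatrix τ = gramMatrix fun x => u x • s x := by
      ext x y
      simp [gramMatrix, hτ, withDefault_dotProduct]
    rw [e, gramMatrix_smul_of_hasGram hs, pairing_tensorPow]
    have hpos := pairing_gramMatrix_nonneg hV fun x => v x • s₀ x
    rw [gramMatrix_smul_of_hasGram hs₀] at hpos
    rw [Complex.eq_re_of_ofReal_le hpos, ← Complex.ofReal_pow, Complex.ofReal_re]
    exact pow_le_pow_left₀ (Complex.le_def.1 hpos).1 hVS k
  have hover : √(δ ^ k) ≤ (∑ x, star (Ψ x) ⬝ᵥ τ x).re := by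
    have hnorm : ∑ x, Complex.normSq (u x) = 1 := by
      have h1 := tensorPow_dotProduct_mulVec (1 : Matrix 𝒟 𝒟 ℂ) v k
      have h2 : tensorPow (1 : Matrix 𝒟 𝒟 ℂ) k = 1 := piKronecker_one
      rw [h2, Matrix.one_mulVec, Matrix.one_mulVec, hv, one_pow] at h1
      have h3 := congrArg Complex.re h1
      rw [← hu, dotProduct, Complex.re_sum, Complex.one_re] at h3
      rw [← h3]
      refine Finset.sum_congr rfl fun x _ => ?_
      simp [Complex.normSq_apply]
    calc √(δ ^ k) = ∑ x, Complex.normSq (u x) * √(δ ^ k) := by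
          rw [← Finset.sum_mul, hnorm, one_mul]
      _ ≤ ∑ x, Complex.normSq (u x)
            * (star (P.state (inputs 𝒟 k x) T) ⬝ᵥ withDefault (s x) z).re :=
          Finset.sum_le_sum fun x _ => mul_le_mul_of_nonneg_left (hP x) (Complex.normSq_nonneg _)
      _ = _ := by
          rw [Complex.re_sum]
          refine Finset.sum_congr rfl fun x _ => ?_
          simp only [hΨ, hτ, star_smul, smul_dotProduct, dotProduct_smul, smul_eq_mul]
          rw [← mul_assoc, ← Complex.re_ofReal_mul, Complex.normSq_eq_conj_mul_self,
            mul_comm (starRingEnd ℂ (u x))]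
          rfl
  have hSk : 0 < S ^ k := pow_pos hS k
  -- the value of `t` that optimises the polarised Cauchy–Schwarz inequality
  set t := √(δ ^ k) / S ^ k with ht
  have ht0 : 0 ≤ t := by positivity
  have hcs := two_mul_overlap_le hWk hVk.1 hWVk Ψ τ t
  have h1 := mul_le_mul_of_nonneg_left hover ht0
  have h2 := mul_le_mul_of_nonneg_left hfinal (sq_nonneg t)
  have h3 : t * S ^ k = √(δ ^ k) := div_mul_cancel₀ _ hSk.ne'
  have h4 : √(δ ^ k) * √(δ ^ k) = δ ^ k := Real.mul_self_sqrt (pow_nonneg hδ k)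
  have h5 : t * √(δ ^ k) ≤ (1 + 2 * γ) ^ T := by
    have : t ^ 2 * S ^ k = t * √(δ ^ k) := by rw [← h3]; ring
    linarith
  calc δ ^ k = t * S ^ k * √(δ ^ k) := by rw [h3, h4]
    _ = S ^ k * (t * √(δ ^ k)) := by ring
    _ ≤ _ := mul_le_mul_of_nonneg_left h5 hSk.le

/-! ### An operator inequality for the inverse -/

/-- If `0 ≤ A ≤ a`, then the inverse `V` of `1 + A` lies below the chord of `x ↦ x⁻¹` between `1`
and `1 + a`. -/
theorem posSemidef_chord_sub_inv {X : Type*} [Fintype X] [DecidableEq X] {A B V : Matrix X X ℂ}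
    {a : ℝ} (ha : 0 < a) (hA : A.PosSemidef) (hB : B.PosSemidef) (hAB : A + B = (a : ℂ) • 1)
    (hV : V.IsHermitian) (hAV : (1 + A) * V = 1) :
    (1 - ((1 + a)⁻¹ : ℂ) • A - V).PosSemidef := by
  have hVA : V * (1 + A) = 1 := mul_eq_one_comm.1 hAV
  have hBe : B = (a : ℂ) • 1 - A := by rw [← hAB]; abel
  have ha1 : (1 + a : ℂ) ≠ 0 := by exact_mod_cast (by linarith : (1 + a : ℝ) ≠ 0)
  have ha0 : (a : ℂ) ≠ 0 := by exact_mod_cast ha.ne'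
  have hABA : (A * B * A).PosSemidef := by
    simpa [hA.1.eq] using hB.conjTranspose_mul_mul_same A
  have hBAB : (B * A * B).PosSemidef := by
    simpa [hB.1.eq] using hA.conjTranspose_mul_mul_same B
  -- `A * B = a⁻¹ (A * B * A + B * A * B)`, because `A` and `B` commute and add up to `a`
  have hM : (((a⁻¹ : ℝ) : ℂ) • (A * B * A + B * A * B) + A * B * A).PosSemidef :=
    ((hABA.add hBAB).smul (by exact_mod_cast (inv_pos.2 ha).le)).add hABA
  have hM' := (hM.conjTranspose_mul_mul_same V).smul (a := (((1 + a)⁻¹ : ℝ) : ℂ))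
    (by exact_mod_cast (by positivity : (0 : ℝ) ≤ (1 + a)⁻¹))
  have e1 : ((a⁻¹ : ℝ) : ℂ) • (A * B * A + B * A * B) + A * B * A = A * B * (1 + A) := by
    have : A * B * A + B * A * B = (a : ℂ) • (A * B) := by
      rw [hBe]
      simp only [mul_sub, sub_mul, Matrix.smul_mul, Matrix.mul_smul, mul_one, one_mul, smul_sub,
        smul_smul, mul_assoc]
      module
    rw [this, smul_smul, Complex.ofReal_inv, inv_mul_cancel₀ ha0, one_smul, mul_add, mul_one]
  have e2 : Vᴴ * (A * B * (1 + A)) * V = (1 + a : ℂ) • (1 - V) - A := by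
    have hVA' : V * A = 1 - V := by
      rw [mul_add, mul_one] at hVA
      rw [← hVA]; abel
    rw [hV.eq, mul_assoc, mul_assoc, hAV, mul_one, ← mul_assoc, hVA', hBe]
    simp only [mul_sub, sub_mul, Matrix.mul_smul, mul_one, one_mul, hVA']
    module
  rw [e1, e2] at hM'
  convert hM' using 1
  rw [smul_sub, smul_smul, Complex.ofReal_inv, Complex.ofReal_add, Complex.ofReal_one,
    inv_mul_cancel₀ ha1, one_smul]
  abel

/-! ### Operator norms and Schur multipliers -/

section Spectral

variable {X : Type*} [Fintype X] [DecidableEq X]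

theorem posSemidef_smul_one_sub {M : Matrix X X ℂ} (hM : M.IsHermitian) {c : ℝ}
    (h : ∀ x : X → ℂ, (star x ⬝ᵥ M *ᵥ x).re ≤ c * (star x ⬝ᵥ x).re) :
    ((c : ℂ) • 1 - M).PosSemidef := by
  refine Matrix.PosSemidef.of_dotProduct_mulVec_nonneg
    ((Matrix.isHermitian_one.smul (by simp [IsSelfAdjoint])).sub hM) fun x => ?_
  have hre : (star x ⬝ᵥ M *ᵥ x).im = 0 := hM.im_star_dotProduct_mulVec_self x
  have him : (star x ⬝ᵥ x).im = 0 := by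
    simp [dotProduct, Complex.im_sum, mul_comm]
  rw [Complex.le_def]
  simp only [Matrix.sub_mulVec, Matrix.smul_mulVec, Matrix.one_mulVec, dotProduct_sub,
    dotProduct_smul, smul_eq_mul, Complex.sub_re, Complex.sub_im, Complex.re_ofReal_mul,
    Complex.im_ofReal_mul, hre, him, Complex.zero_re, Complex.zero_im]
  exact ⟨by linarith [h x], by simp⟩

theorem posSemidef_opNorm_sub {M : Matrix X X ℂ} (hM : M.IsHermitian) :
    ((opNorm M : ℂ) • 1 - M).PosSemidef := by
  refine posSemidef_smul_one_sub hM fun x => ?_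
  set z : EuclideanSpace ℂ X := WithLp.toLp 2 x with hz
  have h1 : star x ⬝ᵥ M *ᵥ x = inner ℂ z (Matrix.toEuclideanCLM (n := X) (𝕜 := ℂ) M z) := by
    rw [EuclideanSpace.inner_eq_star_dotProduct, dotProduct_comm]
    rfl
  have h2 : (star x ⬝ᵥ x).re = ‖z‖ ^ 2 := by
    have h : star x ⬝ᵥ x = inner ℂ z z := by
      rw [EuclideanSpace.inner_eq_star_dotProduct, dotProduct_comm]
    rw [h, inner_self_eq_norm_sq_to_K]
    norm_cast
  rw [h1, h2]
  calc _ ≤ ‖inner ℂ z (Matrix.toEuclideanCLM (n := X) (𝕜 := ℂ) M z)‖ := Complex.re_le_norm _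
    _ ≤ ‖z‖ * ‖Matrix.toEuclideanCLM (n := X) (𝕜 := ℂ) M z‖ := norm_inner_le_norm _ _
    _ ≤ ‖z‖ * (opNorm M * ‖z‖) := by gcongr; exact ContinuousLinearMap.le_opNorm _ _
    _ = _ := by ring

theorem exists_eigenvector_of_mem_spectrum {M : Matrix X X ℂ} {μ : ℂ}
    (h : μ ∈ spectrum ℂ M) : ∃ v : X → ℂ, star v ⬝ᵥ v = 1 ∧ M *ᵥ v = μ • v := by
  rw [spectrum.mem_iff, Matrix.isUnit_iff_isUnit_det, isUnit_iff_ne_zero, not_not] at h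
  obtain ⟨u, hu, h0⟩ := Matrix.exists_mulVec_eq_zero_iff.2 h
  have hMu : M *ᵥ u = μ • u := by
    rw [Algebra.algebraMap_eq_smul_one, Matrix.sub_mulVec, Matrix.smul_mulVec, Matrix.one_mulVec,
      sub_eq_zero] at h0
    exact h0.symm
  set z : EuclideanSpace ℂ X := WithLp.toLp 2 u with hz
  have hz0 : ‖z‖ ≠ 0 := by
    rw [norm_ne_zero_iff]
    exact fun h => hu (by simpa [hz] using h)
  have huu : star u ⬝ᵥ u = (‖z‖ : ℂ) ^ 2 := by
    have h : star u ⬝ᵥ u = inner ℂ z z := by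
      rw [EuclideanSpace.inner_eq_star_dotProduct, dotProduct_comm]
    rw [h, inner_self_eq_norm_sq_to_K]
    rfl
  have hz0' : (‖z‖ : ℂ) ≠ 0 := by exact_mod_cast hz0
  refine ⟨((‖z‖⁻¹ : ℝ) : ℂ) • u, ?_, ?_⟩
  · simp only [star_smul, smul_dotProduct, dotProduct_smul, huu, smul_eq_mul]
    simp
    field_simp
  · rw [Matrix.mulVec_smul, hMu, smul_comm]

open scoped Matrix.Norms.L2Operator in
/-- A nonzero hermitian matrix `M` has a unit eigenvector with eigenvalue `‖M‖` or `-‖M‖`. -/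
theorem exists_eigenvector_opNorm {M : Matrix X X ℂ} (hM : M.IsHermitian) (h0 : 0 < opNorm M) :
    ∃ v : X → ℂ, star v ⬝ᵥ v = 1 ∧
      (M *ᵥ v = (opNorm M : ℂ) • v ∨ M *ᵥ v = (-opNorm M : ℂ) • v) := by
  have hn : opNorm M = ‖M‖ := rfl
  have : Nontrivial (Matrix X X ℂ) := ⟨M, 0, by rintro rfl; simp [hn] at h0⟩
  have hsa : IsSelfAdjoint M := hM
  have mem {r : ℝ} (h : r ∈ spectrum ℝ M) : (r : ℂ) ∈ spectrum ℂ M := by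
    simpa using spectrum.algebraMap_mem ℂ h
  rcases CStarAlgebra.norm_or_neg_norm_mem_spectrum hsa with h | h
  · obtain ⟨v, hv, h⟩ := exists_eigenvector_of_mem_spectrum (mem h)
    exact ⟨v, hv, Or.inl h⟩
  · obtain ⟨v, hv, h⟩ := exists_eigenvector_of_mem_spectrum (mem h)
    exact ⟨v, hv, Or.inr (by simpa [hn] using h)⟩

/-- A factorisation `A x y = ⟨u x | v y⟩` with `‖u x‖², ‖v y‖² ≤ c` makes entrywise multiplication
by `A` increase the norm of a hermitian matrix by at most the factor `c`. -/
theorem posSemidef_smul_sub_hadamard {A B : Matrix X X ℂ} {c : ℝ} {m : ℕ}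
    {u v : X → EuclideanSpace ℂ (Fin m)} (huv : ∀ x, ‖u x‖ ^ 2 ≤ c ∧ ‖v x‖ ^ 2 ≤ c)
    (hA : ∀ x y, A x y = inner ℂ (u x) (v y)) (hAB : (A ⊙ B).IsHermitian)
    (hadd : (1 + B).PosSemidef) (hsub : (1 - B).PosSemidef) :
    ((c : ℂ) • 1 - A ⊙ B).PosSemidef := by
  -- polarisation: `2 Re ⟨p|B|q⟩ ≤ ‖p‖² + ‖q‖²`
  have key (p q : X → ℂ) : 2 * (star p ⬝ᵥ B *ᵥ q).re
      ≤ (star p ⬝ᵥ p).re + (star q ⬝ᵥ q).re := by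
    have hB : B.IsHermitian := by
      simpa using hadd.1.sub Matrix.isHermitian_one
    have h1 := (Complex.le_def.1 (hsub.dotProduct_mulVec_nonneg (p + q))).1
    have h2 := (Complex.le_def.1 (hadd.dotProduct_mulVec_nonneg (p - q))).1
    have h3 : star q ⬝ᵥ B *ᵥ p = star (star p ⬝ᵥ B *ᵥ q) := by
      rw [Matrix.star_dotProduct, Matrix.star_mulVec, hB.eq, Matrix.dotProduct_mulVec]
    have h4 : star q ⬝ᵥ p = star (star p ⬝ᵥ q) := by rw [Matrix.star_dotProduct]
    simp only [Matrix.sub_mulVec, Matrix.add_mulVec, Matrix.one_mulVec, Matrix.mulVec_add,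
      Matrix.mulVec_sub, star_add, star_sub, add_dotProduct, sub_dotProduct, dotProduct_add,
      dotProduct_sub, h3, h4, Complex.add_re, Complex.sub_re, Complex.zero_re] at h1 h2
    simp at h1 h2
    linarith
  refine posSemidef_smul_one_sub hAB fun z => ?_
  set p : Fin m → X → ℂ := fun j x => u x j * z x with hp
  set q : Fin m → X → ℂ := fun j x => v x j * z x with hq
  have hsum : star z ⬝ᵥ (A ⊙ B) *ᵥ z = ∑ j, star (p j) ⬝ᵥ B *ᵥ q j := by
    simp only [dotProduct, Matrix.mulVec, Finset.mul_sum, Pi.star_apply, hp, hq,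
      Matrix.hadamard_apply, hA, PiLp.inner_apply, Finset.sum_mul]
    refine Eq.trans ?_ Finset.sum_comm
    refine Finset.sum_congr rfl fun x _ => ?_
    rw [Finset.sum_comm]
    refine Finset.sum_congr rfl fun j _ => Finset.sum_congr rfl fun y _ => ?_
    simp
    ring
  have hnorm {f : X → EuclideanSpace ℂ (Fin m)} (hf : ∀ x, ‖f x‖ ^ 2 ≤ c) :
      ∑ j, (star (fun x => f x j * z x) ⬝ᵥ fun x => f x j * z x).re ≤ c * (star z ⬝ᵥ z).re := by
    simp only [dotProduct, Complex.re_sum, Pi.star_apply, Finset.mul_sum]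
    rw [Finset.sum_comm]
    refine Finset.sum_le_sum fun x _ => ?_
    have h1 := hf x
    rw [EuclideanSpace.norm_sq_eq] at h1
    have h2 : (star (z x) * z x).re = Complex.normSq (z x) := by
      simp [Complex.normSq_apply]
    rw [h2]
    refine le_trans (le_of_eq ?_) (mul_le_mul_of_nonneg_right h1 (Complex.normSq_nonneg _))
    rw [Finset.sum_mul]
    refine Finset.sum_congr rfl fun j _ => ?_
    rw [← Complex.normSq_eq_norm_sq, ← Complex.normSq_mul]
    simp [Complex.normSq_apply]
    ring
  rw [hsum, Complex.re_sum]
  have h1 := hnorm fun x => (huv x).1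
  have h2 := hnorm fun x => (huv x).2
  have h3 := Finset.sum_le_sum fun j (_ : j ∈ Finset.univ) => key (p j) (q j)
  rw [← Finset.mul_sum, Finset.sum_add_distrib] at h3
  linarith

end Spectral

/-! ### From the additive adversary bound to the number of queries -/

theorem pairing_weighted {X : Type*} [Fintype X] (M σ : Matrix X X ℂ) (v : X → ℂ) :
    pairing M (Matrix.of fun x y => star (v x) * v y * σ x y) = star v ⬝ᵥ (M ⊙ σ) *ᵥ v := by
  simp only [pairing, dotProduct, Matrix.mulVec, Finset.mul_sum, Pi.star_apply, Matrix.of_apply,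
    Matrix.hadamard_apply]
  exact Finset.sum_congr rfl fun x _ => Finset.sum_congr rfl fun y _ => by ring

theorem IsTargetGram.apply_self {X : Type*} {σ : Matrix X X ℂ} (hσ : IsTargetGram σ) (x : X) :
    σ x x = 1 := by
  obtain ⟨m, s, hs, hg⟩ := hσ
  rw [hg, hs]

theorem IsTargetGram.neg_one_le_re {X : Type*} {σ : Matrix X X ℂ} (hσ : IsTargetGram σ)
    (x y : X) : -1 ≤ (σ x y).re := by
  obtain ⟨m, s, hs, hg⟩ := hσ
  have h := (Complex.le_def.1 (dotProduct_star_self_nonneg (s x + s y))).1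
  have hyx : star (s y) ⬝ᵥ s x = star (σ x y) := by rw [hg, Matrix.star_dotProduct]
  rw [star_add, add_dotProduct, dotProduct_add, dotProduct_add, hs, hs, hyx,
    ← hg x y] at h
  simp at h
  linarith

/-- The entries of `J - σ` are `0` or `λ`, and those of a Gram matrix of unit vectors have real
part at least `-1`. -/
theorem IsTargetGram.le_two {X : Type*} {σ : Matrix X X ℂ} (hσ : IsTargetGram σ) {lam : ℝ}
    (hsq : (allOnes X - σ) ⊙ (allOnes X - σ) = (lam : ℂ) • (allOnes X - σ))
    (hne : allOnes X - σ ≠ 0) : lam ≤ 2 := by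
  obtain ⟨x, y, hxy⟩ : ∃ x y, (allOnes X - σ) x y ≠ 0 := by
    by_contra! h
    exact hne (Matrix.ext h)
  have h := congrFun (congrFun hsq x) y
  simp only [Matrix.hadamard_apply, Matrix.smul_apply, smul_eq_mul] at h
  have h1 := congrArg Complex.re (mul_right_cancel₀ hxy h)
  simp [allOnes] at h1
  linarith [hσ.neg_one_le_re x y]

/-- The form `W = 1 + γ (e - Γ)` turns a feasible `Γ` of norm `e` with top eigenvector `v` into a
bound on the number of queries: `⟨v| W |v⟩ = 1`, while `Γ ⊙ σ = (1 - λ) Γ` and the chord bound on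
`W⁻¹` control the expectation of `W⁻¹` in the target state. -/
theorem pow_le_of_witness {n : ℕ} {D : Type*} [Fintype D] [DecidableEq D]
    [AddCommGroup D] {𝒟 : Finset (Fin n → D)} {σ Γ : Matrix 𝒟 𝒟 ℂ} (hσ : IsTargetGram σ)
    {lam : ℝ} (hlam : lam ≤ 2) (hΓσ : Γ ⊙ (allOnes 𝒟 - σ) = (lam : ℂ) • Γ)
    {e : ℝ} (he : 0 < e) (hadd : ((e : ℂ) • 1 + Γ).PosSemidef)
    (hsub : ((e : ℂ) • 1 - Γ).PosSemidef)
    (haddi : ∀ i, (1 + Γ ⊙ (allOnes 𝒟 - Delta 𝒟 i)).PosSemidef)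
    (hsubi : ∀ i, (1 - Γ ⊙ (allOnes 𝒟 - Delta 𝒟 i)).PosSemidef)
    {v : 𝒟 → ℂ} (hv : star v ⬝ᵥ v = 1) (hΓv : Γ *ᵥ v = (e : ℂ) • v)
    {γ : ℝ} (hγ : 0 < γ) {k T : ℕ} {δ : ℝ} (hδ : 0 ≤ δ)
    (hT : CoherentlyGenerates (inputs 𝒟 k) (tensorPow σ k) (1 - δ ^ k) T) :
    δ ^ k * (1 + 2 * γ * e) ^ k ≤ (1 + γ * e * (2 - lam)) ^ k * (1 + 2 * γ) ^ T := by
  have hγ' : (0 : ℂ) ≤ γ := by exact_mod_cast hγ.le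
  set A : Matrix 𝒟 𝒟 ℂ := (γ : ℂ) • ((e : ℂ) • 1 - Γ) with hA
  have hApsd : A.PosSemidef := hsub.smul hγ'
  have hBpsd : ((γ : ℂ) • ((e : ℂ) • 1 + Γ)).PosSemidef := hadd.smul hγ'
  have hunit : IsUnit (1 + A) := (Matrix.PosDef.one.add_posSemidef hApsd).isUnit
  have hWV : (1 + A) * (1 + A)⁻¹ = 1 :=
    Matrix.mul_nonsing_inv _ ((Matrix.isUnit_iff_isUnit_det _).1 hunit)
  have hV : ((1 + A)⁻¹).PosSemidef := (Matrix.PosSemidef.one.add hApsd).inv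
  have ha : 0 < 2 * γ * e := by positivity
  have hc : 0 < 1 + 2 * γ * e := by positivity
  have hS : 0 < (1 + γ * e * (2 - lam)) / (1 + 2 * γ * e) := by
    have : 0 ≤ γ * e * (2 - lam) := mul_nonneg (by positivity) (by linarith)
    positivity
  have hAv : A *ᵥ v = 0 := by
    simp [hA, Matrix.smul_mulVec, Matrix.sub_mulVec, hΓv]
  -- `J - Δ i` vanishes on the diagonal, so only `-γ Γ` survives in `W ⊙ (J - Δ i)`
  have hWi (i : Fin n) : (1 + A) ⊙ (allOnes 𝒟 - Delta 𝒟 i)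
      = -((γ : ℂ) • (Γ ⊙ (allOnes 𝒟 - Delta 𝒟 i))) := by
    ext x y
    rcases eq_or_ne x y with rfl | hxy
    · simp [allOnes, Delta]
    · simp [hA, hxy, mul_assoc]
  have hchord := posSemidef_chord_sub_inv ha hApsd hBpsd
    (by rw [hA, ← smul_add, sub_add_add_cancel, ← add_smul, smul_smul]; congr 1; push_cast; ring)
    hV.1 hWV
  have hVS : (pairing (1 + A)⁻¹ (Matrix.of fun x y => star (v x) * v y * σ x y)).re
      ≤ (1 + γ * e * (2 - lam)) / (1 + 2 * γ * e) := by
    obtain ⟨m, s, hs, hg⟩ := id hσ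
    have h := re_pairing_gramMatrix_nonneg hchord fun x => v x • s x
    rw [gramMatrix_smul_of_hasGram hg, pairing_sub_left, pairing_sub_left, pairing_smul_left,
      pairing_weighted 1, pairing_weighted A] at h
    have h1 : (1 : Matrix 𝒟 𝒟 ℂ) ⊙ σ = 1 := by
      rw [Matrix.one_hadamard_eq_one_iff]
      exact funext hσ.apply_self
    have h2 : Γ ⊙ σ = (1 - lam : ℂ) • Γ := by
      have : Γ ⊙ (allOnes 𝒟 - σ) = Γ - Γ ⊙ σ := by
        ext x y
        simp [allOnes, mul_sub]
      rw [sub_smul, one_smul, ← hΓσ, this, sub_sub_cancel]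
    have h3 : star v ⬝ᵥ (A ⊙ σ) *ᵥ v = ((γ * lam * e : ℝ) : ℂ) := by
      have : A ⊙ σ = (γ : ℂ) • ((e : ℂ) • 1 - (1 - lam : ℂ) • Γ) := by
        rw [← h2, hA, Matrix.smul_hadamard]
        congr 1
        ext x y
        have := congrFun (congrFun h1 x) y
        simp only [Matrix.hadamard_apply] at this
        simp [sub_mul, mul_assoc, this]
      rw [this]
      simp only [Matrix.smul_mulVec, Matrix.sub_mulVec, Matrix.one_mulVec, hΓv, dotProduct_smul,
        dotProduct_sub, hv, smul_eq_mul]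
      push_cast
      ring
    rw [h1, Matrix.one_mulVec, hv, h3] at h
    have h4 : ((1 + (2 * γ * e : ℝ) : ℂ)⁻¹ * ((γ * lam * e : ℝ) : ℂ)).re
        = (1 + 2 * γ * e)⁻¹ * (γ * lam * e) := by
      rw [← Complex.ofReal_one, ← Complex.ofReal_add, ← Complex.ofReal_inv, ← Complex.ofReal_mul,
        Complex.ofReal_re]
    rw [Complex.sub_re, Complex.sub_re, h4, Complex.one_re] at h
    have h5 : (1 + γ * e * (2 - lam)) / (1 + 2 * γ * e)
        = 1 - (1 + 2 * γ * e)⁻¹ * (γ * lam * e) := by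
      field_simp
      ring
    rw [h5]
    linarith
  have main := pow_le_of_coherentlyGenerates hσ hγ.le (W := 1 + A)
    (by rwa [add_sub_cancel_left]) hV hWV
    (fun i => by rw [hWi, ← sub_eq_add_neg, ← smul_sub]; exact (hsubi i).smul hγ')
    (fun i => by rw [hWi, sub_neg_eq_add, ← smul_add]; exact (haddi i).smul hγ')
    hv (by rw [Matrix.add_mulVec, hAv, add_zero, Matrix.one_mulVec, hv]) hS hVS hδ hT
  rw [div_pow, div_mul_eq_mul_div, le_div_iff₀ (pow_pos hc k)] at main
  exact main

/-- Entrywise multiplication by `J - σ` and rescaling turn a nearly optimal solution `Γ` of the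
additive adversary bound into a witness of norm `e`, for every `e < d`: this is feasible by the
defining property of `γ₂`, and `(J - σ) ⊙ (J - σ) = λ (J - σ)` gives `Γ ⊙ (J - σ) = λ Γ`. -/
theorem pow_le_of_lt {n : ℕ} {D : Type*} [Fintype D] [DecidableEq D]
    [AddCommGroup D] {𝒟 : Finset (Fin n → D)} {σ : Matrix 𝒟 𝒟 ℂ} (hσ : IsTargetGram σ)
    {lam : ℝ} (hlam : lam ≤ 2)
    (hsq : (allOnes 𝒟 - σ) ⊙ (allOnes 𝒟 - σ) = (lam : ℂ) • (allOnes 𝒟 - σ))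
    (hγ₂ : 0 < gammaTwo (allOnes 𝒟 - σ)) {e : ℝ} (he : 0 < e)
    (hed : e < ADV 𝒟 σ / gammaTwo (allOnes 𝒟 - σ))
    {γ : ℝ} (hγ : 0 < γ) {k T : ℕ} {δ : ℝ} (hδ : 0 ≤ δ)
    (hT : CoherentlyGenerates (inputs 𝒟 k) (tensorPow σ k) (1 - δ ^ k) T) :
    δ ^ k * (1 + 2 * γ * e) ^ k ≤ (1 + γ * e * (2 - lam)) ^ k * (1 + 2 * γ) ^ T := by
  have hH : (allOnes 𝒟 - σ).IsHermitian := by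
    obtain ⟨m, s, hs, hg⟩ := hσ
    ext x y
    have h : star (σ y x) = σ x y := by rw [hg, hg, Matrix.star_dotProduct, star_star]
    rw [Matrix.conjTranspose_apply, Matrix.sub_apply, Matrix.sub_apply, star_sub, h]
    simp [allOnes]
  rw [lt_div_iff₀ hγ₂] at hed
  obtain ⟨Γ, hΓ, hfeas, hr⟩ : ∃ Γ : Matrix 𝒟 𝒟 ℂ, Γ.IsHermitian ∧
      (∀ i, (1 + Γ ⊙ (allOnes 𝒟 - Delta 𝒟 i)).PosSemidef ∧
        (1 - Γ ⊙ (allOnes 𝒟 - Delta 𝒟 i)).PosSemidef) ∧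
      e * gammaTwo (allOnes 𝒟 - σ) < opNorm (Γ ⊙ (allOnes 𝒟 - σ)) := by
    by_contra! h
    exact absurd hed (not_lt.2 (Real.sSup_le (by rintro _ ⟨Γ, h1, h2, rfl⟩; exact h Γ h1 h2)
      (by positivity)))
  set M := Γ ⊙ (allOnes 𝒟 - σ) with hM
  have hMh : M.IsHermitian := hΓ.hadamard hH
  have hr0 : 0 < opNorm M := lt_trans (by positivity) hr
  obtain ⟨c, ⟨-, m, u, v, huv, hfac⟩, hc⟩ :=
    exists_lt_of_csInf_lt (Set.nonempty_iff_ne_empty.2 fun h => by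
      rw [gammaTwo, h, Real.sInf_empty] at hγ₂
      exact hγ₂.false) ((lt_div_iff₀ he).2 (by rwa [mul_comm] at hr) :
        gammaTwo (allOnes 𝒟 - σ) < opNorm M / e)
  rw [lt_div_iff₀ he] at hc
  have hs0 : (0 : ℂ) ≤ ((e / opNorm M : ℝ) : ℂ) := by
    exact_mod_cast (by positivity : 0 ≤ e / opNorm M)
  have hsM : ((e / opNorm M : ℝ) : ℂ) * (opNorm M : ℂ) = e := by
    rw [← Complex.ofReal_mul, div_mul_cancel₀ _ hr0.ne']
  -- the witness, up to the sign that makes `e` the top eigenvalue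
  set Γ' := ((e / opNorm M : ℝ) : ℂ) • M with hΓ'
  have hsub : ((e : ℂ) • 1 - Γ').PosSemidef := by
    have := (posSemidef_opNorm_sub hMh).smul hs0
    rwa [smul_sub, smul_smul, hsM] at this
  have hadd : ((e : ℂ) • 1 + Γ').PosSemidef := by
    have h1 : opNorm (-M) = opNorm M := by rw [opNorm, map_neg, norm_neg, opNorm]
    have := (posSemidef_opNorm_sub hMh.neg).smul hs0
    rwa [smul_sub, smul_smul, h1, hsM, smul_neg, sub_neg_eq_add] at this
  have hΓσ : Γ' ⊙ (allOnes 𝒟 - σ) = (lam : ℂ) • Γ' := by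
    rw [hΓ', Matrix.smul_hadamard, hM, Matrix.hadamard_assoc, hsq, Matrix.hadamard_smul, smul_comm]
  have hdiag (i : Fin n) : (allOnes 𝒟 - Delta 𝒟 i).IsHermitian := by
    ext x y
    simp [allOnes, Delta, eq_comm, apply_ite]
  have scale {B : Matrix 𝒟 𝒟 ℂ} (hB : ((c : ℂ) • 1 - B).PosSemidef) :
      (1 - ((e / opNorm M : ℝ) : ℂ) • B).PosSemidef := by
    have h1 := hB.smul hs0
    have h2 : (0 : ℂ) ≤ ((1 - e / opNorm M * c : ℝ) : ℂ) := by
      have : e / opNorm M * c ≤ 1 := by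
        rw [div_mul_eq_mul_div, div_le_one hr0]
        linarith
      exact_mod_cast (by linarith : 0 ≤ 1 - e / opNorm M * c)
    convert h1.add ((Matrix.PosSemidef.one (n := 𝒟) (R := ℂ)).smul h2) using 1
    rw [smul_sub, smul_smul, Complex.ofReal_sub, Complex.ofReal_mul, Complex.ofReal_one]
    module
  have hcomm (i : Fin n) : Γ' ⊙ (allOnes 𝒟 - Delta 𝒟 i) = ((e / opNorm M : ℝ) : ℂ) •
      ((allOnes 𝒟 - σ) ⊙ (Γ ⊙ (allOnes 𝒟 - Delta 𝒟 i))) := by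
    rw [hΓ', Matrix.smul_hadamard, hM, Matrix.hadamard_comm Γ, Matrix.hadamard_assoc]
  have hsubi (i : Fin n) : (1 - Γ' ⊙ (allOnes 𝒟 - Delta 𝒟 i)).PosSemidef := by
    rw [hcomm]
    exact scale (posSemidef_smul_sub_hadamard huv hfac (hH.hadamard (hΓ.hadamard (hdiag i)))
      (hfeas i).1 (hfeas i).2)
  have haddi (i : Fin n) : (1 + Γ' ⊙ (allOnes 𝒟 - Delta 𝒟 i)).PosSemidef := by
    have h := posSemidef_smul_sub_hadamard (B := -(Γ ⊙ (allOnes 𝒟 - Delta 𝒟 i))) huv hfac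
      (hH.hadamard (hΓ.hadamard (hdiag i)).neg) (by rw [← sub_eq_add_neg]; exact (hfeas i).2)
      (by rw [sub_neg_eq_add]; exact (hfeas i).1)
    have h' := scale h
    rw [hcomm]
    convert h' using 1
    ext x y
    simp
  obtain ⟨w, hw, hMw | hMw⟩ := exists_eigenvector_opNorm hMh hr0
  · exact pow_le_of_witness hσ hlam hΓσ he hadd hsub haddi hsubi hw
      (by rw [hΓ', Matrix.smul_mulVec, hMw, smul_smul, hsM]) hγ hδ hT
  · have hneg (B : Matrix 𝒟 𝒟 ℂ) : (-Γ') ⊙ B = -(Γ' ⊙ B) := by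
      ext x y
      simp
    refine pow_le_of_witness (Γ := -Γ') hσ hlam (by rw [hneg, hΓσ, smul_neg]) he
      (by rwa [← sub_eq_add_neg]) (by rwa [sub_neg_eq_add])
      (fun i => by rw [hneg, ← sub_eq_add_neg]; exact hsubi i)
      (fun i => by rw [hneg, sub_neg_eq_add]; exact haddi i) hw ?_ hγ hδ hT
    rw [Matrix.neg_mulVec, hΓ', Matrix.smul_mulVec, hMw, neg_smul, smul_neg, neg_neg, smul_smul,
      hsM]

/-- The bound for a single number of queries `T`: the logarithm of the limit `e → d` of
`pow_le_of_lt`. -/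
theorem log_le_of_coherentlyGenerates {n : ℕ} {D : Type*} [Fintype D] [DecidableEq D]
    [AddCommGroup D] {𝒟 : Finset (Fin n → D)} {σ : Matrix 𝒟 𝒟 ℂ} (hσ : IsTargetGram σ)
    {lam : ℝ}
    (hsq : (allOnes 𝒟 - σ) ⊙ (allOnes 𝒟 - σ) = (lam : ℂ) • (allOnes 𝒟 - σ))
    {d : ℝ} (hd : d = ADV 𝒟 σ / gammaTwo (allOnes 𝒟 - σ)) {k T : ℕ} {δ : ℝ} (hδ0 : 0 < δ)
    (hδ1 : δ ≤ 1) {γ : ℝ} (hγ : 0 < γ)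
    (hT : CoherentlyGenerates (inputs 𝒟 k) (tensorPow σ k) (1 - δ ^ k) T) :
    k * Real.log (δ * ((1 + 2 * γ * d) / (1 + γ * d * (2 - lam)))) / (2 * Real.log (1 + γ))
      ≤ T := by
  have hlog : 0 < Real.log (1 + γ) := Real.log_pos (by linarith)
  rw [div_le_iff₀ (by positivity)]
  have hADV : 0 ≤ ADV 𝒟 σ := Real.sSup_nonneg (by rintro _ ⟨Γ, -, -, rfl⟩; exact norm_nonneg _)
  have hγ₂ : 0 ≤ gammaTwo (allOnes 𝒟 - σ) := Real.sInf_nonneg fun c hc => hc.1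
  have hd0 : 0 ≤ d := hd ▸ div_nonneg hADV hγ₂
  -- for `d = 0`, which includes the case `σ = J`, the argument of the logarithm is `δ ≤ 1`
  rcases hd0.eq_or_lt with h0 | hdpos
  · have : Real.log δ ≤ 0 := Real.log_nonpos hδ0.le hδ1
    have h2 : (k : ℝ) * Real.log δ ≤ 0 := mul_nonpos_of_nonneg_of_nonpos (by positivity) this
    have h3 : (0 : ℝ) ≤ T * (2 * Real.log (1 + γ)) := by positivity
    simpa [← h0] using h2.trans h3
  have hγ₂pos : 0 < gammaTwo (allOnes 𝒟 - σ) := hγ₂.lt_of_ne' fun h => by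
    rw [hd, h, div_zero] at hdpos
    exact hdpos.false
  have hlam : lam ≤ 2 := hσ.le_two hsq fun h => by
    have : ADV 𝒟 σ ≤ 0 := Real.sSup_le (by rintro _ ⟨Γ, -, -, rfl⟩; simp [h, opNorm]) le_rfl
    rw [hd, this.antisymm hADV, zero_div] at hdpos
    exact hdpos.false
  have hb : 0 < 1 + γ * d * (2 - lam) := by
    have : 0 ≤ γ * d * (2 - lam) := mul_nonneg (by positivity) (by linarith)
    positivity
  have hbound : δ ^ k * (1 + 2 * γ * d) ^ k ≤ (1 + γ * d * (2 - lam)) ^ k * (1 + 2 * γ) ^ T := by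
    have hmem : d ∈ closure (Set.Ioo 0 d) := by
      rw [closure_Ioo hdpos.ne]
      exact ⟨hd0, le_rfl⟩
    exact le_on_closure (f := fun e => δ ^ k * (1 + 2 * γ * e) ^ k)
      (g := fun e => (1 + γ * e * (2 - lam)) ^ k * (1 + 2 * γ) ^ T)
      (fun e he => pow_le_of_lt hσ hlam hsq hγ₂pos he.1 (hd ▸ he.2) hγ hδ0.le hT)
      (by fun_prop) (by fun_prop) hmem
  have hpow : (δ * ((1 + 2 * γ * d) / (1 + γ * d * (2 - lam)))) ^ k ≤ (1 + γ) ^ (2 * T) := by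
    rw [mul_pow, div_pow, ← mul_div_assoc, div_le_iff₀ (pow_pos hb k),
      mul_comm ((1 + γ) ^ (2 * T))]
    refine hbound.trans ?_
    rw [pow_mul]
    gcongr
    nlinarith [sq_nonneg γ]
  have h1 := Real.log_le_log (by positivity) hpow
  rw [Real.log_pow, Real.log_pow] at h1
  push_cast at h1
  linarith

end StateGen

theorem mainTheorem4 {n : ℕ} {D : Type*} [Fintype D] [DecidableEq D] [AddCommGroup D]
    (𝒟 : Finset (Fin n → D)) (σ : Matrix 𝒟 𝒟 ℂ) (hσ : StateGen.IsTargetGram σ)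
    (lam : ℝ) (hlam : 0 < lam)
    (hsq : (StateGen.allOnes 𝒟 - σ) ⊙ (StateGen.allOnes 𝒟 - σ)
      = (lam : ℂ) • (StateGen.allOnes 𝒟 - σ))
    (d : ℝ) (hd : d = StateGen.ADV 𝒟 σ / StateGen.gammaTwo (StateGen.allOnes 𝒟 - σ))
    (k : ℕ) (δ : ℝ) (hδ0 : 0 < δ) (hδ1 : δ ≤ 1) (γ : ℝ) (hγ : 0 < γ) :
    ((k * Real.log (δ * ((1 + 2 * γ * d) / (1 + γ * d * (2 - lam))))
        / (2 * Real.log (1 + γ)) : ℝ) : EReal)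
      ≤ ((StateGen.coherentComplexity (StateGen.inputs 𝒟 k) (StateGen.tensorPow σ k)
          (1 - δ ^ k) : ENNReal) : EReal) := by
  rw [StateGen.coherentComplexity]
  set Q : Set ℕ∞ := {q | ∃ T : ℕ, StateGen.CoherentlyGenerates (StateGen.inputs 𝒟 k)
    (StateGen.tensorPow σ k) (1 - δ ^ k) T ∧ q = T}
  rcases Q.eq_empty_or_nonempty with hQ | hQ
  · simp [hQ]
  · obtain ⟨T, hT, hq⟩ := csInf_mem hQ
    rw [hq]
    have h := StateGen.log_le_of_coherentlyGenerates hσ hsq hd hδ0 hδ1 hγ hT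
    refine (EReal.coe_le_coe_iff.2 h).trans (le_of_eq ?_)
    rw [ENat.toENNReal_coe, EReal.coe_natCast]
    rfl
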